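/- Let $R$ be a commutative ring. For a class $\mathcal X$ of $R$-modules, let $\mathcal G(\mathcal X)$ be the class of all $R$-modules $M$ for which there is an exact complex $$X=\cdots\xrightarrow{\partial_2}X_1\xrightarrow{\partial_1}X_0\xrightarrow{\partial_0}X_{-1}\to\cdots$$ indexed by $\mathbb Z$, with every $X_i$ in $\mathcal X$, such that the complexes $\operatorname{Hom}_R(X,H)$ and $\operatorname{Hom}_R(H,X)$ are exact for each $H\in\mathcal X$, and $M\cong\operatorname{Coker}(\partial_1)$. Set $\mathcal G^0(\mathcal X)=\mathcal X$ and $\mathcal G^{n+1}(\mathcal X)=\mathcal G(\mathcal G^n(\mathcal X))$ for $n\ge 0$. Let $\mathcal P(R)$ and $\mathcal I(R)$ be the classes of projective and of injective $R$-modules. Let $\mathcal{GP}(R)$ be the class of Gorenstein projective $R$-modules, that is, of modules isomorphic to $\operatorname{Coker}(\partial_1)$ for some exact complex $P$ of projective $R$-modules indexed by $\mathbb Z$ such that $\operatorname{Hom}_R(P,Q)$ is exact for each projective $R$-module $Q$. Dually, let $\mathcal{GI}(R)$ be the class of Gorenstein injective $R$-modules, that is, of modules isomorphic to $\operatorname{Ker}(\partial_0)$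 for some exact complex $I$ of injective $R$-modules indexed by $\mathbb Z$ such that $\operatorname{Hom}_R(J,I)$ is exact for each injective $R$-module $J$. Then $$\mathcal{GP}(R)=\mathcal G(\mathcal{GP}(R))\quad\text{and}\quad \mathcal G^n(\mathcal P(R))=\mathcal{GP}(R)\ \text{ for every } n\ge 1,$$ $$\mathcal{GI}(R)=\mathcal G(\mathcal{GI}(R))\quad\text{and}\quad \mathcal G^n(\mathcal I(R))=\mathcal{GI}(R)\ \text{ for every } n\ge 1.$$ In particular $\mathcal G(\mathcal P(R))=\mathcal G^2(\mathcal P(R))$ and $\mathcal G(\mathcal I(R))=\mathcal G^2(\mathcal I(R))$. -/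

import Mathlib

open CategoryTheory CategoryTheory.Limits

universe v u

namespace GorensteinCat

variable {C : Type u} [Category.{v} C] [Abelian C]

/-- The complex of abelian groups `Hom(H, K)` is exact (in every degree). -/
def HomFromExact (H : C) (K : ChainComplex C ℤ) : Prop :=
  ∀ n : ℤ, Function.Exact
    (fun f : H ⟶ K.X (n + 1) => f ≫ K.d (n + 1) n)
    (fun f : H ⟶ K.X n => f ≫ K.d n (n - 1))

/-- The complex of abelian groups `Hom(K, H)` is exact (in every degree). -/
def HomToExact (K : ChainComplex C ℤ) (H : C) : Prop :=
  ∀ n : ℤ, Function.Exact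
    (fun f : K.X (n - 1) ⟶ H => K.d n (n - 1) ≫ f)
    (fun f : K.X n ⟶ H => K.d (n + 1) n ≫ f)

/-- `K` is totally `X`-acyclic: an exact complex of objects of `X` that is both `Hom(X, -)`-exact
and `Hom(-, X)`-exact. -/
structure IsTotallyAcyclic (X : ObjectProperty C) (K : ChainComplex C ℤ) : Prop where
  mem : ∀ n : ℤ, X (K.X n)
  exact : K.Acyclic
  homFrom : ∀ H : C, X H → HomFromExact H K
  homTo : ∀ H : C, X H → HomToExact K H

/-- The Gorenstein class `G(X)`: the objects isomorphic to `Coker (∂₁ : K₁ ⟶ K₀)` for some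
totally `X`-acyclic complex `K`. -/
def gorenstein (X : ObjectProperty C) : ObjectProperty C := fun M =>
  ∃ K : ChainComplex C ℤ, IsTotallyAcyclic X K ∧ Nonempty (M ≅ cokernel (K.d 1 0))

/-- The iterates: `G⁰(X) = X` and `Gⁿ⁺¹(X) = G(Gⁿ(X))`. -/
def gorensteinIter (X : ObjectProperty C) : ℕ → ObjectProperty C
  | 0 => X
  | n + 1 => gorenstein (gorensteinIter X n)

variable (C) in
/-- Gorenstein projective objects: the objects isomorphic to `Coker (∂₁ : P₁ ⟶ P₀)` for some exact
complex `P` of projectives such that `Hom(P, Q)` is exact for every projective `Q`. -/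
def gorensteinProjective : ObjectProperty C := fun M =>
  ∃ P : ChainComplex C ℤ, (∀ n : ℤ, Projective (P.X n)) ∧ P.Acyclic ∧
    (∀ Q : C, Projective Q → HomToExact P Q) ∧ Nonempty (M ≅ cokernel (P.d 1 0))

variable (C) in
/-- Gorenstein injective objects: the objects isomorphic to `Ker (∂₀ : I₀ ⟶ I₋₁)` for some exact
complex `I` of injectives such that `Hom(J, I)` is exact for every injective `J`. -/
def gorensteinInjective : ObjectProperty C := fun N =>
  ∃ I : ChainComplex C ℤ, (∀ n : ℤ, Injective (I.X n)) ∧ I.Acyclic ∧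
    (∀ J : C, Injective J → HomFromExact J I) ∧ Nonempty (N ≅ kernel (I.d 0 (-1)))

end GorensteinCat

/-!
Both halves hold in every abelian category, and the injective half is the projective half in the
opposite category.

A totally acyclic complex is the splice of a sequence `(Zₙ)` indexed by `ℤ` in which `Zₙ₊₁` is a
syzygy of `Zₙ`: there is a short exact sequence `0 ⟶ Zₙ₊₁ ⟶ Eₙ ⟶ Zₙ ⟶ 0` with `Eₙ` in the class,
exact under `Hom` into and out of the class (`IsTotallyAcyclic.isSyzygy`,
`exists_isTotallyAcyclic`). So an object belongs to `G(X)` as soon as it lies in a class of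
objects that have syzygies in the same class, and in a possibly different class of objects that
are syzygies of members of that same class (`gorenstein_of_forall_exists`). This description is
self-dual (`gorenstein_op`). As `Hom(P, K)` is exact whenever `P` is projective and `K` is exact,
the Gorenstein projectives are `G(X)` for `X` the class of projectives, and dually for the
injectives.

Write `G` for the class of Gorenstein projectives. What makes a sequence `0 ⟶ A ⟶ E ⟶ B ⟶ 0` with
`E` projective a syzygy sequence is the vanishing of `Ext¹(B, Q)` for all projective `Q`. This
holds for `B` in `G` and, by the long exact sequence, for `B` in `G(G)`, and it passes to
extensions. A horseshoe argument made of pushouts and pullbacks then shows that `G` is closed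
under extensions (`gorenstein_extension`).

For `G(G) ≤ G`, let `M` be an extension `0 ⟶ Z ⟶ M ⟶ A ⟶ 0` of `A` in `G` by `Z` in `G(G)`. Embed
`Z` in `E` in `G` with quotient `Z'` in `G(G)`. The pushout `B` of `M` and `E` under `Z` is an
extension of `A` by `E`, hence in `G`, and embeds in a projective with quotient `B'` in `G`. The
composite embedding of `M` has a quotient that is an extension of `B'` by `Z'`, so that the step
can be repeated. Dually, an extension of an object of `G(G)` by one of `G` is covered by a
projective with kernel of the same kind. An object of `G(G)` is trivially of both kinds
(`gorenstein_gorenstein_isProjective_le`).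
-/

universe w

namespace GorensteinCat

open Opposite
open scoped ZeroObject

variable {C : Type u} [Category.{v} C] [Abelian C]

/-! ### Short exact sequences of objects -/

lemma shortExact_of_forall_exists_desc {A B D : C} {f : A ⟶ B} {g : B ⟶ D} (w : f ≫ g = 0)
    [Mono f] [Epi g] (h : ∀ (T : C) (k : B ⟶ T), f ≫ k = 0 → ∃ l, g ≫ l = k) :
    (ShortComplex.mk f g w).ShortExact := by
  choose l hl using h
  have : Mono (ShortComplex.mk f g w).f := ‹Mono f›
  have : Epi (ShortComplex.mk f g w).g := ‹Epi g›
  exact ⟨ShortComplex.exact_of_g_is_cokernel _ (CokernelCofork.IsColimit.ofπ g w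
    (fun k hk => l _ k hk) (fun k hk => hl _ k hk)
    (fun k hk m hm => by rw [← cancel_epi g, hl, hm]))⟩

/-- There is a short exact sequence `0 ⟶ A ⟶ B ⟶ D ⟶ 0`. -/
def SES (A B D : C) : Prop :=
  ∃ (f : A ⟶ B) (g : B ⟶ D) (w : f ≫ g = 0), (ShortComplex.mk f g w).ShortExact

namespace SES

lemma op {A B D : C} : SES A B D → SES (op D) (op B) (op A) := by
  rintro ⟨f, g, w, h⟩
  exact ⟨g.op, f.op, by rw [← op_comp, w, op_zero], h.op⟩

lemma unop {A B D : C} : SES (Opposite.op D) (Opposite.op B) (Opposite.op A) → SES A B D := by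
  rintro ⟨f, g, w, h⟩
  exact ⟨g.unop, f.unop, by rw [← unop_comp, w, unop_zero], h.unop⟩

/-- The pushout of `0 ⟶ A ⟶ B ⟶ D ⟶ 0` along `x : A ⟶ X`. -/
lemma of_pushout {A B D X : C} {f : A ⟶ B} {g : B ⟶ D} {w : f ≫ g = 0}
    (h : (ShortComplex.mk f g w).ShortExact) (x : A ⟶ X) : SES X (Limits.pushout f x) D := by
  have : Mono f := h.mono_f
  have : Epi g := h.epi_g
  let p : Limits.pushout f x ⟶ D := pushout.desc g 0 (by rw [w, comp_zero])
  have hp : pushout.inl f x ≫ p = g := pushout.inl_desc _ _ _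
  have hp' : pushout.inr f x ≫ p = 0 := pushout.inr_desc _ _ _
  have : Epi (pushout.inl f x ≫ p) := by rwa [hp]
  have : Epi p := epi_of_epi (pushout.inl f x) p
  refine ⟨pushout.inr f x, p, hp', shortExact_of_forall_exists_desc _ fun T k hk => ?_⟩
  refine ⟨h.exact.desc (pushout.inl f x ≫ k) ?_, ?_⟩
  · change f ≫ _ = 0
    rw [pushout.condition_assoc, hk, comp_zero]
  · apply pushout.hom_ext
    · rw [reassoc_of% hp]
      exact h.exact.g_desc _ _
    · rw [reassoc_of% hp']
      exact zero_comp.trans hk.symm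

/-- For monomorphisms `A ⟶ B` and `A ⟶ X` with cokernels `D` and `Y`, the pushout `E` is at once
an extension of `D` by `X` and of `Y` by `B`. -/
lemma pushout {A B D X Y : C} (h : SES A B D) (h' : SES A X Y) :
    ∃ E, SES X E D ∧ SES B E Y := by
  obtain ⟨f, g, w, h⟩ := h
  obtain ⟨f', g', w', h'⟩ := h'
  obtain ⟨a, b, hab, h₂⟩ : SES B (Limits.pushout f' f) Y := of_pushout h' f
  let e := pushoutSymmetry f' f
  refine ⟨Limits.pushout f f', of_pushout h f', a ≫ e.hom, e.inv ≫ b,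
    by simp [hab], ShortComplex.shortExact_of_iso ?_ h₂⟩
  exact ShortComplex.isoMk (Iso.refl _) e (Iso.refl _) (by simp) (by simp)

/-- For epimorphisms `B ⟶ D` and `X ⟶ D` with kernels `A` and `Y`, the pullback `E` is at once an
extension of `X` by `A` and of `B` by `Y`. -/
lemma pullback {A B D X Y : C} (h : SES A B D) (h' : SES Y X D) :
    ∃ E, SES A E X ∧ SES Y E B := by
  obtain ⟨E, h₁, h₂⟩ := h.op.pushout h'.op
  exact ⟨E.unop, h₁.unop, h₂.unop⟩

/-- The sequence `0 ⟶ B/A ⟶ Y/A ⟶ Y/B ⟶ 0` for `A ⊆ B ⊆ Y`. -/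
lemma quotient {A B D Y E : C} (h : SES A B D) (h' : SES B Y E) :
    ∃ N, SES A Y N ∧ SES D N E := by
  obtain ⟨f, g, w, h⟩ := h
  obtain ⟨f', g', w', h'⟩ := h'
  have : Mono f := h.mono_f
  have : Epi g := h.epi_g
  have : Mono f' := h'.mono_f
  refine ⟨Limits.pushout f' g, ⟨f ≫ f', pushout.inl f' g, by
    rw [Category.assoc, pushout.condition, reassoc_of% w, zero_comp],
    shortExact_of_forall_exists_desc _ fun T k hk => ?_⟩, of_pushout h' g⟩
  exact ⟨pushout.desc k (h.exact.desc (f' ≫ k) (by simpa using hk)) (h.exact.g_desc _ _).symm,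
    pushout.inl_desc _ _ _⟩

/-- The sequence `0 ⟶ K ⟶ N ⟶ A ⟶ 0` for epimorphisms `Y ⟶ B ⟶ D`, where `K` is the kernel of `Y ⟶
B` and `N` the kernel of the composite. -/
lemma kernel {A B D Y K : C} (h : SES A B D) (h' : SES K Y B) :
    ∃ N, SES N Y D ∧ SES K N A := by
  obtain ⟨N, h₁, h₂⟩ := h.op.quotient h'.op
  exact ⟨N.unop, h₁.unop, h₂.unop⟩

lemma of_splitting {A B D : C} {f : A ⟶ B} {g : B ⟶ D} {w : f ≫ g = 0}
    (s : (ShortComplex.mk f g w).Splitting) : SES D B A := by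
  have hs : s.s ≫ s.r = 0 := s.s_r
  let t : (ShortComplex.mk s.s s.r hs).Splitting :=
    { r := g
      s := f
      f_r := s.s_g
      s_g := s.f_r
      id := by
        have := s.id
        dsimp at this ⊢
        rw [add_comm]; exact this }
  exact ⟨s.s, s.r, hs, t.shortExact⟩

lemma swap_of_projective {A B D : C} [Projective D] (h : SES A B D) : SES D B A := by
  obtain ⟨f, g, w, h⟩ := h
  have : Epi g := h.epi_g
  have : Mono f := h.mono_f
  exact of_splitting (.ofExactOfSection _ h.exact (Projective.factorThru (𝟙 _) g) (by simp)
    inferInstance)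

lemma projective {A B D : C} (h : SES A B D) (hA : Projective A) (hD : Projective D) :
    Projective B := by
  obtain ⟨f, g, w, h⟩ := h
  have : Epi g := h.epi_g
  have : Mono f := h.mono_f
  let s : (ShortComplex.mk f g w).Splitting :=
    .ofExactOfSection _ h.exact (Projective.factorThru (𝟙 _) g) (by simp) inferInstance
  exact Projective.of_iso s.isoBinaryBiproduct.symm (inferInstanceAs (Projective (A ⊞ D)))

lemma id_zero (M : C) {Z : C} (hZ : IsZero Z) : SES Z M M := by
  have : Mono (0 : Z ⟶ M) := ⟨fun _ _ _ => hZ.eq_of_tgt _ _⟩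
  exact ⟨0, 𝟙 M, by simp, shortExact_of_forall_exists_desc _ fun T k _ => ⟨k, by simp⟩⟩

end SES

/-! ### Objects orthogonal to the projectives -/

section

variable [HasExt.{w} C]

/-- `M` is orthogonal to the projectives: `Ext¹(M, Q) = 0` for every projective `Q`. -/
def ExtOrthogonal : ObjectProperty C := fun M =>
  ∀ Q : C, Projective Q → Subsingleton (Abelian.Ext M Q 1)

open Abelian

lemma ExtOrthogonal.of_projective {M : C} (hM : Projective M) : ExtOrthogonal M :=
  fun _ _ => Ext.subsingleton_of_projective _ _ 0

lemma ExtOrthogonal.extension {A B D : C} (h : SES A B D) (hA : ExtOrthogonal A)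
    (hD : ExtOrthogonal D) : ExtOrthogonal B := by
  obtain ⟨f, g, w, h⟩ := h
  intro Q hQ
  have := hA Q hQ
  have := hD Q hQ
  refine subsingleton_of_forall_eq 0 fun x => ?_
  obtain ⟨y, rfl⟩ := Ext.contravariant_sequence_exact₂ h Q x (Subsingleton.elim _ _)
  rw [Subsingleton.elim y 0, Ext.comp_zero]

lemma ExtOrthogonal.exists_comp_eq {S : ShortComplex C} (hS : S.ShortExact)
    (h : ExtOrthogonal S.X₃) {Q : C} (hQ : Projective Q) (a : S.X₁ ⟶ Q) :
    ∃ b, S.f ≫ b = a := by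
  have := h Q hQ
  obtain ⟨x, hx⟩ := Ext.contravariant_sequence_exact₁ hS Q (Ext.mk₀ a) (n₁ := 1) rfl
    (Subsingleton.elim _ _)
  obtain ⟨b, rfl⟩ := Ext.homEquiv₀.symm.surjective x
  refine ⟨b, Ext.homEquiv₀.symm.injective ?_⟩
  simpa using hx

lemma ExtOrthogonal.of_forall_exists_comp_eq {S : ShortComplex C} (hS : S.ShortExact)
    (h₂ : ExtOrthogonal S.X₂)
    (h : ∀ Q : C, Projective Q → ∀ a : S.X₁ ⟶ Q, ∃ b, S.f ≫ b = a) : ExtOrthogonal S.X₃ := by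
  intro Q hQ
  have := h₂ Q hQ
  refine subsingleton_of_forall_eq 0 fun x => ?_
  obtain ⟨y, rfl⟩ := Ext.contravariant_sequence_exact₃ hS Q x (Subsingleton.elim _ _)
    (n₀ := 0) rfl
  obtain ⟨a, rfl⟩ := Ext.homEquiv₀.symm.surjective y
  obtain ⟨b, rfl⟩ := h Q hQ a
  simp [← Ext.mk₀_comp_mk₀]

lemma SES.swap_of_extOrthogonal {A B D : C} (h : SES A B D) (hA : Projective A)
    (hD : ExtOrthogonal D) : SES D B A := by
  obtain ⟨f, g, w, h⟩ := h
  obtain ⟨r, hr⟩ := hD.exists_comp_eq h hA (𝟙 A)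
  exact .of_splitting (.ofExactOfRetraction _ h.exact r hr h.epi_g)

end

/-! ### Totally acyclic complexes as sequences of syzygies -/

lemma nonempty_kernel_comp_iso {A B D T : C} {f : A ⟶ B} {g : B ⟶ D} {w : f ≫ g = 0}
    (h : (ShortComplex.mk f g w).ShortExact) (i : D ⟶ T) [Mono i] :
    Nonempty (kernel (g ≫ i) ≅ A) :=
  ⟨kernelCompMono g i ≪≫ IsLimit.conePointUniqueUpToIso (kernelIsKernel g) h.fIsKernel⟩

lemma nonempty_cokernel_comp_iso {A B D T : C} {f : A ⟶ B} {g : B ⟶ D} {w : f ≫ g = 0}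
    (h : (ShortComplex.mk f g w).ShortExact) (p : T ⟶ A) [Epi p] :
    Nonempty (cokernel (p ≫ f) ≅ D) :=
  ⟨cokernelEpiComp p f ≪≫
    IsColimit.coconePointUniqueUpToIso (cokernelIsCokernel f) h.gIsCokernel⟩

/-- Exactness of `Hom(H, K)`, stated around the degree `n + 1` so that no subtraction occurs. -/
lemma homFromExact_iff {H : C} {K : ChainComplex C ℤ} :
    HomFromExact H K ↔ ∀ (n : ℤ) (f : H ⟶ K.X (n + 1)), f ≫ K.d (n + 1) n = 0 →
      ∃ h, h ≫ K.d (n + 1 + 1) (n + 1) = f := by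
  have key : HomFromExact H K ↔ ∀ n k : ℤ, k + 1 = n → Function.Exact
      (fun f : H ⟶ K.X (n + 1) => f ≫ K.d (n + 1) n) (fun f : H ⟶ K.X n => f ≫ K.d n k) := by
    refine ⟨fun h n k hk => ?_, fun h n => h n (n - 1) (by lia)⟩
    obtain rfl : k = n - 1 := by lia
    exact h n
  rw [key]
  constructor
  · intro h n f hf
    exact (h (n + 1) n rfl f).1 hf
  · rintro h _ k rfl f
    refine ⟨fun hf => h k f hf, ?_⟩
    rintro ⟨a, rfl⟩
    simp

/-- Exactness of `Hom(K, H)`, stated around the degree `n + 1` so that no subtraction occurs. -/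
lemma homToExact_iff {H : C} {K : ChainComplex C ℤ} :
    HomToExact K H ↔ ∀ (n : ℤ) (f : K.X (n + 1) ⟶ H), K.d (n + 1 + 1) (n + 1) ≫ f = 0 →
      ∃ h, K.d (n + 1) n ≫ h = f := by
  have key : HomToExact K H ↔ ∀ n k : ℤ, k + 1 = n → Function.Exact
      (fun f : K.X k ⟶ H => K.d n k ≫ f) (fun f : K.X n ⟶ H => K.d (n + 1) n ≫ f) := by
    refine ⟨fun h n k hk => ?_, fun h n => h n (n - 1) (by lia)⟩
    obtain rfl : k = n - 1 := by lia
    exact h n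
  rw [key]
  constructor
  · intro h n f hf
    exact (h (n + 1) n rfl f).1 hf
  · rintro h _ k rfl f
    refine ⟨fun hf => h k f hf, ?_⟩
    rintro ⟨a, rfl⟩
    simp

lemma acyclic_iff {K : ChainComplex C ℤ} :
    K.Acyclic ↔ ∀ n : ℤ, (K.sc' (n + 1 + 1) (n + 1) n).Exact := by
  have key (n : ℤ) : K.ExactAt (n + 1) ↔ (K.sc' (n + 1 + 1) (n + 1) n).Exact :=
    K.exactAt_iff' _ _ _ (by simp) (by simp)
  refine ⟨fun h n => (key n).1 (h _), fun h n => ?_⟩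
  obtain ⟨m, rfl⟩ : ∃ m, n = m + 1 := ⟨n - 1, by lia⟩
  exact (key m).2 (h m)

/-- `A` is a first `X`-syzygy of `B`: there is a short exact sequence `0 ⟶ A ⟶ E ⟶ B ⟶ 0` with `E`
in `X`, on which both `Hom(H, -)` and `Hom(-, H)` are exact for every `H` in `X`. As these
functors are left exact, only the lifting and the extension of morphisms are required. -/
def IsSyzygy (X : ObjectProperty C) (A B : C) : Prop :=
  ∃ (E : C) (i : A ⟶ E) (p : E ⟶ B) (w : i ≫ p = 0), X E ∧ (ShortComplex.mk i p w).ShortExact ∧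
    (∀ H, X H → ∀ b : H ⟶ B, ∃ h, h ≫ p = b) ∧ (∀ H, X H → ∀ a : A ⟶ H, ∃ h, i ≫ h = a)

/-- The cokernels of consecutive differentials of a totally acyclic complex are syzygies of one
another. -/
lemma IsTotallyAcyclic.isSyzygy {X : ObjectProperty C} {K : ChainComplex C ℤ}
    (hK : IsTotallyAcyclic X K) {k m n : ℤ} (hk : m + 1 = k) (hm : n + 1 = m) :
    IsSyzygy X (cokernel (K.d k m)) (cokernel (K.d m n)) := by
  subst hk hm
  let i : cokernel (K.d (n + 1 + 1) (n + 1)) ⟶ K.X n := cokernel.desc _ (K.d (n + 1) n) (by simp)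
  let p := cokernel.π (K.d (n + 1) n)
  have hi : cokernel.π (K.d (n + 1 + 1) (n + 1)) ≫ i = K.d (n + 1) n := cokernel.π_desc _ _ _
  have hiM : Mono i := (acyclic_iff.1 hK.exact n).mono_cokernelDesc
  have w : i ≫ p = 0 := by
    rw [← cancel_epi (cokernel.π (K.d (n + 1 + 1) (n + 1))), reassoc_of% hi, comp_zero]
    exact cokernel.condition _
  refine ⟨K.X n, i, p, w, hK.mem n, shortExact_of_forall_exists_desc w fun T k hk => ?_,
    fun H hH b => ?_, fun H hH a => ?_⟩
  · exact ⟨cokernel.desc _ k (by rw [← hi, Category.assoc, hk, comp_zero]), cokernel.π_desc _ _ _⟩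
  · obtain ⟨m, rfl⟩ : ∃ m, n = m + 1 := ⟨n - 1, by lia⟩
    let j : cokernel (K.d (m + 1 + 1) (m + 1)) ⟶ K.X m := cokernel.desc _ (K.d (m + 1) m) (by simp)
    have hj : p ≫ j = K.d (m + 1) m := cokernel.π_desc _ _ _
    have hjM : Mono j := (acyclic_iff.1 hK.exact m).mono_cokernelDesc
    obtain ⟨k, rfl⟩ : ∃ k, m = k + 1 := ⟨m - 1, by lia⟩
    obtain ⟨h, hh⟩ := homFromExact_iff.1 (hK.homFrom H hH) k (b ≫ j) (by
      have : j ≫ K.d (k + 1) k = 0 := by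
        rw [← cancel_epi p, reassoc_of% hj, K.d_comp_d, comp_zero]
      rw [Category.assoc, this, comp_zero])
    exact ⟨h, by rw [← cancel_mono j, Category.assoc, hj, hh]⟩
  · obtain ⟨h, hh⟩ := homToExact_iff.1 (hK.homTo H hH) n (cokernel.π _ ≫ a)
      (by rw [cokernel.condition_assoc, zero_comp])
    exact ⟨h, by rw [← cancel_epi (cokernel.π (K.d (n + 1 + 1) (n + 1))), reassoc_of% hi, hh]⟩

/-- A sequence of syzygies splices to a totally acyclic complex: its differentials are the
composites `Eₙ₊₁ ⟶ Zₙ₊₁ ⟶ Eₙ`. -/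
lemma exists_isTotallyAcyclic {X : ObjectProperty C} (Z : ℤ → C)
    (hZ : ∀ n, IsSyzygy X (Z (n + 1)) (Z n)) :
    ∃ K : ChainComplex C ℤ, IsTotallyAcyclic X K ∧ Nonempty (kernel (K.d 0 (-1)) ≅ Z 1) ∧
      Nonempty (cokernel (K.d 1 0) ≅ Z 0) := by
  choose E i p w hX hS hfrom hto using hZ
  have hi n : Mono (i n) := (hS n).mono_f
  have hp n : Epi (p n) := (hS n).epi_g
  let K : ChainComplex C ℤ := ChainComplex.of E (fun n => p (n + 1) ≫ i n)
    (fun n => by rw [Category.assoc, reassoc_of% w (n + 1), zero_comp, comp_zero])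
  have hd n : K.d (n + 1) n = p (n + 1) ≫ i n :=
    ChainComplex.of_d E (fun n => p (n + 1) ≫ i n) n
  refine ⟨K, ⟨hX, acyclic_iff.2 fun n => ?_, fun H hH => homFromExact_iff.2 fun n f hf => ?_,
    fun H hH => homToExact_iff.2 fun n f hf => ?_⟩, ?_, ?_⟩
  · -- Both arrows of `0 ⟶ Zₙ₊₂ ⟶ Eₙ₊₁ ⟶ Zₙ₊₁ ⟶ 0` are extended, on the left by an epimorphism
    -- and on the right by a monomorphism, which keeps exactness in the middle.
    let S := ShortComplex.mk (K.d (n + 1 + 1) (n + 1)) (p (n + 1))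
      (by rw [hd, Category.assoc, w, comp_zero])
    let φ : S ⟶ ShortComplex.mk (i (n + 1)) (p (n + 1)) (w (n + 1)) :=
      { τ₁ := p (n + 1 + 1), τ₂ := 𝟙 _, τ₃ := 𝟙 _, comm₁₂ := by simp [S, hd] }
    let ψ : S ⟶ K.sc' (n + 1 + 1) (n + 1) n :=
      { τ₁ := 𝟙 _
        τ₂ := 𝟙 _
        τ₃ := i n
        comm₁₂ := (Category.id_comp _).trans (Category.comp_id _).symm
        comm₂₃ := (Category.id_comp _).trans (hd n) }
    have : Epi φ.τ₁ := hp _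
    have : IsIso φ.τ₂ := inferInstanceAs (IsIso (𝟙 _))
    have : Mono φ.τ₃ := inferInstanceAs (Mono (𝟙 _))
    have : Epi ψ.τ₁ := inferInstanceAs (Epi (𝟙 _))
    have : IsIso ψ.τ₂ := inferInstanceAs (IsIso (𝟙 _))
    have : Mono ψ.τ₃ := hi n
    rw [← ShortComplex.exact_iff_of_epi_of_isIso_of_mono ψ,
      ShortComplex.exact_iff_of_epi_of_isIso_of_mono φ]
    exact (hS (n + 1)).exact
  · have hf' : f ≫ p (n + 1) = 0 := by
      rwa [← cancel_mono (i n), Category.assoc, zero_comp, ← hd]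
    obtain ⟨h, hh⟩ := hfrom (n + 1 + 1) H hH ((hS (n + 1)).exact.lift f hf')
    exact ⟨h, by rw [hd, reassoc_of% hh]; exact (hS (n + 1)).exact.lift_f f hf'⟩
  · have hf' : i (n + 1) ≫ f = 0 := by
      rwa [← cancel_epi (p (n + 1 + 1)), comp_zero, ← Category.assoc, ← hd]
    obtain ⟨h, hh⟩ := hto n H hH ((hS (n + 1)).exact.desc f hf')
    exact ⟨h, by rw [hd, Category.assoc, hh]; exact (hS (n + 1)).exact.g_desc f hf'⟩
  · have := hd (-1)
    obtain ⟨e⟩ := nonempty_kernel_comp_iso (hS 0) (i (-1))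
    exact ⟨kernelIsoOfEq this ≪≫ e⟩
  · obtain ⟨e⟩ := nonempty_cokernel_comp_iso (hS 0) (p (0 + 1))
    exact ⟨cokernelIsoOfEq (hd 0) ≪≫ e⟩

lemma gorenstein_of_iso {X : ObjectProperty C} {M N : C} (e : M ≅ N) :
    gorenstein X N → gorenstein X M := by
  rintro ⟨K, hK, ⟨e'⟩⟩
  exact ⟨K, hK, ⟨e ≪≫ e'⟩⟩

lemma gorenstein_of_int_family {X : ObjectProperty C} (Z : ℤ → C)
    (hZ : ∀ n, IsSyzygy X (Z (n + 1)) (Z n)) (n : ℤ) : gorenstein X (Z n) := by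
  obtain ⟨K, hK, -, ⟨e⟩⟩ := exists_isTotallyAcyclic (X := X) (fun k => Z (n + k))
    (fun k => by simpa only [add_assoc] using hZ (n + k))
  exact ⟨K, hK, ⟨(eqToIso (by simp)) ≪≫ e.symm⟩⟩

lemma IsSyzygy.of_iso {X : ObjectProperty C} {A A' B B' : C} (h : IsSyzygy X A B) (e : A' ≅ A)
    (e' : B' ≅ B) : IsSyzygy X A' B' := by
  obtain ⟨E, i, p, w, hE, hS, h₁, h₂⟩ := h
  refine ⟨E, e.hom ≫ i, p ≫ e'.inv, by simp [reassoc_of% w], hE, ShortComplex.shortExact_of_iso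
    (S₁ := .mk i p w) (ShortComplex.isoMk e.symm (Iso.refl _) e'.symm (by simp) (by simp)) hS,
    fun H hH b => ?_, fun H hH a => ?_⟩
  · obtain ⟨h, hh⟩ := h₁ H hH (b ≫ e'.hom)
    exact ⟨h, by rw [reassoc_of% hh]; simp⟩
  · obtain ⟨h, hh⟩ := h₂ H hH (e.inv ≫ a)
    exact ⟨h, by rw [Category.assoc, hh]; simp⟩

lemma exists_isSyzygy_left {X : ObjectProperty C} {M : C} (h : gorenstein X M) :
    ∃ N, gorenstein X N ∧ IsSyzygy X N M := by
  obtain ⟨K, hK, ⟨e⟩⟩ := h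
  exact ⟨_, gorenstein_of_int_family (fun n => cokernel (K.d (n + 1) n))
    (fun _ => hK.isSyzygy rfl rfl) 1, (hK.isSyzygy (m := 1) rfl rfl).of_iso (Iso.refl _) e⟩

lemma exists_isSyzygy_right {X : ObjectProperty C} {M : C} (h : gorenstein X M) :
    ∃ N, gorenstein X N ∧ IsSyzygy X M N := by
  obtain ⟨K, hK, ⟨e⟩⟩ := h
  exact ⟨_, gorenstein_of_int_family (fun n => cokernel (K.d (n + 1) n))
    (fun _ => hK.isSyzygy rfl rfl) (-1),
    (hK.isSyzygy (m := 0) (by simp) (by simp)).of_iso e (Iso.refl _)⟩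

/-- Splices a sequence continued to the left inside `L` and one continued to the right inside `R`.
-/
lemma exists_int_family {α : Type*} {r : α → α → Prop} {L R : α → Prop}
    (hL : ∀ a, L a → ∃ b, L b ∧ r b a) (hR : ∀ a, R a → ∃ b, R b ∧ r a b) {a : α} (hLa : L a)
    (hRa : R a) : ∃ Z : ℤ → α, Z 0 = a ∧ ∀ n, r (Z (n + 1)) (Z n) := by
  choose! l hl hl' using hL
  choose! s hs hs' using hR
  have hln (n : ℕ) : L (l^[n] a) := by
    induction n with
    | zero => exact hLa
    | succ n ih => rw [Function.iterate_succ_apply']; exact hl _ ih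
  have hsn (n : ℕ) : R (s^[n] a) := by
    induction n with
    | zero => exact hRa
    | succ n ih => rw [Function.iterate_succ_apply']; exact hs _ ih
  let Z : ℤ → α := fun n => match n with
    | .ofNat n => l^[n] a
    | .negSucc n => s^[n + 1] a
  refine ⟨Z, rfl, fun n => ?_⟩
  match n with
  | .ofNat n =>
    change r (l^[n + 1] a) (l^[n] a)
    rw [Function.iterate_succ_apply']
    exact hl' _ (hln n)
  | .negSucc 0 => exact hs' _ hRa
  | .negSucc (n + 1) =>
    change r (s^[n + 1] a) (s^[n + 1 + 1] a)
    rw [Function.iterate_succ_apply' s (n + 1)]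
    exact hs' _ (hsn (n + 1))

/-- An object lies in the Gorenstein class as soon as syzygies can be continued indefinitely in
both directions; the two directions may use different classes of objects. -/
lemma gorenstein_of_forall_exists {X : ObjectProperty C} {L R : ObjectProperty C}
    (hL : ∀ A, L A → ∃ B, L B ∧ IsSyzygy X B A) (hR : ∀ A, R A → ∃ B, R B ∧ IsSyzygy X A B)
    {M : C} (hLM : L M) (hRM : R M) : gorenstein X M := by
  obtain ⟨Z, rfl, hZ⟩ := exists_int_family hL hR hLM hRM
  exact gorenstein_of_int_family Z hZ 0

/-- The complex `0 ⟶ M ⟶ M ⟶ 0` shows that `X ≤ G(X)`: with a zero object in `X`, each object of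
`X` has the zero object as a syzygy and is a syzygy of it. -/
lemma le_gorenstein {X : ObjectProperty C} {Z : C} (hZ : IsZero Z) (hXZ : X Z) :
    X ≤ gorenstein X := by
  refine fun M hM => gorenstein_of_forall_exists (L := X) (R := X) (fun A hA => ⟨Z, hXZ, ?_⟩)
    (fun A hA => ⟨Z, hXZ, ?_⟩) hM hM
  · obtain ⟨i, p, w, h⟩ := SES.id_zero A hZ
    have : Mono i := h.mono_f
    have : IsIso p := h.isIso_g_iff.2 hZ
    exact ⟨A, i, p, w, hA, h, fun H _ b => ⟨b ≫ inv p, by simp⟩,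
      fun H _ a => ⟨0, hZ.eq_of_src _ _⟩⟩
  · obtain ⟨i, p, w, h⟩ := (SES.id_zero (op A) hZ.op).unop
    have : IsIso i := h.isIso_f_iff.2 hZ
    exact ⟨A, i, p, w, hA, h, fun H _ b => ⟨0, hZ.eq_of_tgt _ _⟩,
      fun H _ a => ⟨inv i ≫ a, by simp⟩⟩

/-! ### Duality -/

lemma IsSyzygy.op {X : ObjectProperty C} {A B : C} : IsSyzygy X A B →
    IsSyzygy X.op (op B) (op A) := by
  rintro ⟨E, i, p, w, hE, h, h₁, h₂⟩
  refine ⟨Opposite.op E, p.op, i.op, by rw [← op_comp, w, op_zero], hE, h.op, fun H hH b => ?_,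
    fun H hH a => ?_⟩
  · obtain ⟨k, hk⟩ := h₂ H.unop hH b.unop
    exact ⟨k.op, by rw [← op_comp, hk]; rfl⟩
  · obtain ⟨k, hk⟩ := h₁ H.unop hH a.unop
    exact ⟨k.op, by rw [← op_comp, hk]; rfl⟩

lemma IsSyzygy.unop {X : ObjectProperty C} {A B : Cᵒᵖ} : IsSyzygy X.op A B →
    IsSyzygy X B.unop A.unop := by
  rintro ⟨E, i, p, w, hE, h, h₁, h₂⟩
  refine ⟨E.unop, p.unop, i.unop, by rw [← unop_comp, w, unop_zero], hE, h.unop, fun H hH b => ?_,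
    fun H hH a => ?_⟩
  · obtain ⟨k, hk⟩ := h₂ (Opposite.op H) hH b.op
    exact ⟨k.unop, by rw [← unop_comp, hk]; rfl⟩
  · obtain ⟨k, hk⟩ := h₁ (Opposite.op H) hH a.op
    exact ⟨k.unop, by rw [← unop_comp, hk]; rfl⟩

/-- Being a syzygy is self-dual, so reversing a sequence of syzygies gives one in `Cᵒᵖ`. -/
lemma gorenstein_op (X : ObjectProperty C) : gorenstein X.op = (gorenstein X).op := by
  ext M
  constructor
  · refine fun h => gorenstein_of_forall_exists (L := fun A => gorenstein X.op (op A))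
      (R := fun A => gorenstein X.op (op A)) (fun A hA => ?_) (fun A hA => ?_) h h
    · obtain ⟨N, hN, h⟩ := exists_isSyzygy_right hA
      exact ⟨N.unop, hN, h.unop⟩
    · obtain ⟨N, hN, h⟩ := exists_isSyzygy_left hA
      exact ⟨N.unop, hN, h.unop⟩
  · refine fun h => gorenstein_of_forall_exists (L := (gorenstein X).op)
      (R := (gorenstein X).op) (fun A hA => ?_) (fun A hA => ?_) h h
    · obtain ⟨N, hN, h⟩ := exists_isSyzygy_right hA
      exact ⟨Opposite.op N, hN, h.op⟩
    · obtain ⟨N, hN, h⟩ := exists_isSyzygy_left hA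
      exact ⟨Opposite.op N, hN, h.op⟩

/-! ### Gorenstein projective and injective objects as Gorenstein classes -/

lemma homFromExact_of_projective {P : C} (hP : Projective P) {K : ChainComplex C ℤ}
    (hK : K.Acyclic) : HomFromExact P K :=
  homFromExact_iff.2 fun n f hf =>
    ⟨(acyclic_iff.1 hK n).liftFromProjective f hf,
      (acyclic_iff.1 hK n).liftFromProjective_comp f hf⟩

lemma homToExact_of_injective {J : C} (hJ : Injective J) {K : ChainComplex C ℤ}
    (hK : K.Acyclic) : HomToExact K J :=
  homToExact_iff.2 fun n f hf =>
    ⟨(acyclic_iff.1 hK n).descToInjective f hf, (acyclic_iff.1 hK n).comp_descToInjective f hf⟩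

variable (C)

lemma gorensteinProjective_eq : gorensteinProjective C = gorenstein (isProjective C) := by
  ext M
  constructor
  · rintro ⟨K, h₁, h₂, h₃, e⟩
    exact ⟨K, ⟨h₁, h₂, fun P hP => homFromExact_of_projective hP h₂, h₃⟩, e⟩
  · rintro ⟨K, ⟨h₁, h₂, -, h₃⟩, e⟩
    exact ⟨K, h₁, h₂, h₃, e⟩

/-- The two definitions differ by a shift: `Ker ∂₀` in one place, `Coker ∂₁ ≅ Ker ∂₋₁` in the
other. Shifting the sequence of syzygies avoids shifting complexes. -/
lemma gorensteinInjective_eq : gorensteinInjective C = gorenstein (isInjective C) := by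
  ext M
  constructor
  · rintro ⟨K, h₁, h₂, h₃, ⟨e⟩⟩
    have hK : IsTotallyAcyclic (isInjective C) K :=
      ⟨h₁, h₂, h₃, fun J hJ => homToExact_of_injective hJ h₂⟩
    -- The kernel of `∂₀` is the image of `∂₁`, hence the cokernel of `∂₂`.
    let i : cokernel (K.d 2 1) ⟶ K.X 0 := cokernel.desc _ (K.d 1 0) (by simp)
    have hi : cokernel.π (K.d 2 1) ≫ i = K.d 1 0 := cokernel.π_desc _ _ _
    have : Mono i := (acyclic_iff.1 h₂ 0).mono_cokernelDesc
    let S := ShortComplex.mk i (K.d 0 (-1))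
      (by rw [← cancel_epi (cokernel.π (K.d 2 1)), reassoc_of% hi]; simp)
    let φ : K.sc' 1 0 (-1) ⟶ S :=
      { τ₁ := cokernel.π (K.d 2 1)
        τ₂ := 𝟙 _
        τ₃ := 𝟙 _
        comm₁₂ := hi.trans (Category.comp_id _).symm
        comm₂₃ := (Category.id_comp _).trans (Category.comp_id _).symm }
    have : Epi φ.τ₁ := inferInstanceAs (Epi (cokernel.π (K.d 2 1)))
    have : IsIso φ.τ₂ := inferInstanceAs (IsIso (𝟙 _))
    have : Mono φ.τ₃ := inferInstanceAs (Mono (𝟙 _))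
    have hS : S.Exact :=
      (ShortComplex.exact_iff_of_epi_of_isIso_of_mono φ).1
        ((K.exactAt_iff' 1 0 (-1) (by simp) (by simp)).1 (h₂ 0))
    have : Mono S.f := ‹Mono i›
    let e' : kernel (K.d 0 (-1)) ≅ cokernel (K.d 2 1) :=
      IsLimit.conePointUniqueUpToIso (kernelIsKernel _) hS.fIsKernel
    exact gorenstein_of_iso (e ≪≫ e')
      (gorenstein_of_int_family (fun n => cokernel (K.d (n + 1) n))
        (fun _ => hK.isSyzygy rfl rfl) 1)
  · rintro ⟨K, hK, ⟨e⟩⟩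
    obtain ⟨Z, ⟨e₀⟩, hZ⟩ : ∃ Z : ℤ → C, Nonempty (cokernel (K.d 1 0) ≅ Z (1 - 1)) ∧
        ∀ n, IsSyzygy (isInjective C) (Z (n + 1)) (Z n) :=
      ⟨fun n => cokernel (K.d (n + 1) n), ⟨Iso.refl _⟩, fun _ => hK.isSyzygy rfl rfl⟩
    obtain ⟨K', hK', ⟨e'⟩, -⟩ := exists_isTotallyAcyclic (fun n => Z (n - 1))
      (fun n => by simpa using hZ (n - 1))
    exact ⟨K', hK'.mem, hK'.exact, hK'.homFrom, ⟨e ≪≫ e₀ ≪≫ e'.symm⟩⟩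

lemma isProjective_le_gorenstein : isProjective C ≤ gorenstein (isProjective C) :=
  le_gorenstein (isZero_zero C) (inferInstanceAs (Projective (0 : C)))

variable {C}

/-! ### Extensions of Gorenstein projective objects -/

section

variable [HasExt.{w} C]

/-- A syzygy sequence relative to a class between the projectives and their orthogonal ends in an
object orthogonal to the projectives. -/
lemma IsSyzygy.exists_ses {X : ObjectProperty C} (hX : isProjective C ≤ X)
    (hX' : X ≤ ExtOrthogonal) {A B : C} : IsSyzygy X A B →
    ∃ E, X E ∧ SES A E B ∧ ExtOrthogonal B := by
  rintro ⟨E, i, p, w, hE, h, -, hto⟩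
  exact ⟨E, hE, ⟨i, p, w, h⟩,
    ExtOrthogonal.of_forall_exists_comp_eq h (hX' _ hE) fun Q hQ => hto Q (hX _ hQ)⟩

/-- Orthogonality of `B` makes `Hom(-, Q)` exact on the sequence for projective `Q`; `Hom(Q, -)`
is exact on it in any case. -/
lemma SES.isSyzygy {A P B : C} (h : SES A P B) (hP : Projective P) (hB : ExtOrthogonal B) :
    IsSyzygy (isProjective C) A B := by
  obtain ⟨i, p, w, h⟩ := h
  have : Epi p := h.epi_g
  exact ⟨P, i, p, w, hP, h, fun H hH b => ⟨Projective.factorThru b p, by simp⟩,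
    fun H hH a => hB.exists_comp_eq h hH a⟩

lemma exists_ses_left {M : C} (h : gorenstein (isProjective C) M) :
    ∃ P N, Projective P ∧ SES N P M ∧ gorenstein (isProjective C) N ∧ ExtOrthogonal M := by
  obtain ⟨N, hN, h⟩ := exists_isSyzygy_left h
  obtain ⟨P, hP, h, h'⟩ := h.exists_ses le_rfl fun _ => ExtOrthogonal.of_projective
  exact ⟨P, N, hP, h, hN, h'⟩

lemma gorenstein_le_extOrthogonal : gorenstein (isProjective C) ≤ ExtOrthogonal := by
  intro M hM
  obtain ⟨_, _, _, _, _, h⟩ := exists_ses_left hM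
  exact h

lemma exists_ses_right {M : C} (h : gorenstein (isProjective C) M) :
    ∃ P N, Projective P ∧ SES M P N ∧ gorenstein (isProjective C) N := by
  obtain ⟨N, hN, h⟩ := exists_isSyzygy_right h
  obtain ⟨P, hP, h, -⟩ := h.exists_ses le_rfl fun _ => ExtOrthogonal.of_projective
  exact ⟨P, N, hP, h, hN⟩

/-- Gorenstein projective objects are closed under extensions. -/
lemma gorenstein_extension {A B D : C} (h : SES A B D) (hA : gorenstein (isProjective C) A)
    (hD : gorenstein (isProjective C) D) : gorenstein (isProjective C) B := by
  let W : ObjectProperty C := fun B => ∃ A D, SES A B D ∧ gorenstein (isProjective C) A ∧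
    gorenstein (isProjective C) D
  have hW : W ≤ ExtOrthogonal := by
    rintro B ⟨A, D, h, hA, hD⟩
    exact .extension h (gorenstein_le_extOrthogonal _ hA) (gorenstein_le_extOrthogonal _ hD)
  refine gorenstein_of_forall_exists (L := W) (R := W) ?_ ?_ ⟨A, D, h, hA, hD⟩ ⟨A, D, h, hA, hD⟩
  · rintro B hB
    have hB' := hW _ hB
    obtain ⟨A, D, h, hA, hD⟩ := hB
    obtain ⟨P, A', hP, hA', gA, -⟩ := exists_ses_left hA
    obtain ⟨Q, D', hQ, hD', gD, -⟩ := exists_ses_left hD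
    -- The extension `E` of the projective `Q` by `A` splits, so that `E` maps onto `A` with kernel
    -- `Q`, and pulling back along `P ⟶ A` covers `E` by a projective `F`.
    obtain ⟨E, h₁, h₂⟩ := h.pullback hD'
    obtain ⟨F, h₃, h₄⟩ := h₁.swap_of_projective.pullback hA'
    obtain ⟨N, h₅, h₆⟩ := h₂.kernel h₄
    exact ⟨N, ⟨A', D', h₆, gA, gD⟩, h₅.isSyzygy (h₃.projective hQ hP) hB'⟩
  · rintro B ⟨A, D, h, hA, hD⟩
    obtain ⟨P, A', hP, hA', gA⟩ := exists_ses_right hA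
    obtain ⟨Q, D', hQ, hD', gD⟩ := exists_ses_right hD
    -- `E` is an extension of `D` by the projective `P`. It splits, so `D` embeds in it with
    -- quotient `P`, and pushing out along `D ⟶ Q` embeds `E` in a projective `F`.
    obtain ⟨E, h₁, h₂⟩ := h.pushout hA'
    obtain ⟨F, h₃, h₄⟩ :=
      (h₁.swap_of_extOrthogonal hP (gorenstein_le_extOrthogonal _ hD)).pushout hD'
    obtain ⟨N, h₅, h₆⟩ := h₂.quotient h₄
    have hN : W N := ⟨A', D', h₆, gA, gD⟩
    exact ⟨N, hN, h₅.isSyzygy (h₃.projective hQ hP) (hW _ hN)⟩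

/-! ### Stability -/

variable (C) in
/-- Iterating the construction gives nothing new. Write `G` for the Gorenstein projectives and
`G²` for `G(G)`. Extensions of `G²` by `G` are quotients of projectives with kernel of the same
kind, and extensions of `G` by `G²` embed in projectives with cokernel of the same kind; every
object of `G²` is both, and the two kinds need not be compared. -/
lemma gorenstein_gorenstein_isProjective_le :
    gorenstein (gorenstein (isProjective C)) ≤ gorenstein (isProjective C) := by
  let G := gorenstein (isProjective C)
  have key {A B : C} (h : IsSyzygy G A B) : ∃ E, G E ∧ SES A E B ∧ ExtOrthogonal B :=
    h.exists_ses (isProjective_le_gorenstein C) gorenstein_le_extOrthogonal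
  have hGG {M : C} (hM : gorenstein G M) : ExtOrthogonal M := by
    obtain ⟨_, _, h⟩ := exists_isSyzygy_left hM
    obtain ⟨_, _, _, h⟩ := key h
    exact h
  let L : ObjectProperty C := fun M => ∃ A Z, SES A M Z ∧ G A ∧ gorenstein G Z
  let R : ObjectProperty C := fun M => ∃ Z A, SES Z M A ∧ gorenstein G Z ∧ G A
  have hL : L ≤ ExtOrthogonal := by
    rintro M ⟨A, Z, h, hA, hZ⟩
    exact .extension h (gorenstein_le_extOrthogonal _ hA) (hGG hZ)
  have hR : R ≤ ExtOrthogonal := by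
    rintro M ⟨Z, A, h, hZ, hA⟩
    exact .extension h (hGG hZ) (gorenstein_le_extOrthogonal _ hA)
  have h0 : G (0 : C) :=
    isProjective_le_gorenstein C _ (inferInstanceAs (Projective (0 : C)))
  refine fun M hM => gorenstein_of_forall_exists (L := L) (R := R) ?_ ?_
    ⟨0, M, .id_zero M (isZero_zero C), h0, hM⟩
    ⟨M, 0, (SES.id_zero (op M) (isZero_zero C).op).unop, hM, h0⟩
  · intro M hM
    have hM' := hL _ hM
    obtain ⟨A, Z, h, hA, hZ⟩ := hM
    obtain ⟨Z', gZ', hZ'⟩ := exists_isSyzygy_left hZ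
    obtain ⟨E, hE, hZ', -⟩ := key hZ'
    obtain ⟨B, h₁, h₂⟩ := h.pullback hZ'
    obtain ⟨P, B', hP, hB', gB', -⟩ := exists_ses_left (gorenstein_extension h₁ hA hE)
    obtain ⟨N, h₃, h₄⟩ := h₂.kernel hB'
    exact ⟨N, ⟨B', Z', h₄, gB', gZ'⟩, h₃.isSyzygy hP hM'⟩
  · rintro M ⟨Z, A, h, hZ, hA⟩
    obtain ⟨Z', gZ', hZ'⟩ := exists_isSyzygy_right hZ
    obtain ⟨E, hE, hZ', -⟩ := key hZ'
    -- `B` is an extension of `A` by `E`, hence in `G`, and `M` embeds in it with quotient `Z'`.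
    obtain ⟨B, h₁, h₂⟩ := h.pushout hZ'
    obtain ⟨P, B', hP, hB', gB'⟩ := exists_ses_right (gorenstein_extension h₁ hE hA)
    obtain ⟨N, h₃, h₄⟩ := h₂.quotient hB'
    have hN : R N := ⟨Z', B', h₄, gZ', gB'⟩
    exact ⟨N, hN, h₃.isSyzygy hP (hR _ hN)⟩

end

variable (C)

lemma gorenstein_gorenstein_isProjective :
    gorenstein (gorenstein (isProjective C)) = gorenstein (isProjective C) := by
  have := HasExt.standard C
  exact le_antisymm (gorenstein_gorenstein_isProjective_le C)
    (le_gorenstein (isZero_zero C)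
      (isProjective_le_gorenstein C _ (inferInstanceAs (Projective (0 : C)))))

lemma gorenstein_gorenstein_isInjective :
    gorenstein (gorenstein (isInjective C)) = gorenstein (isInjective C) := by
  have h : (isInjective C).op = isProjective Cᵒᵖ := by
    ext J
    exact Injective.injective_iff_projective_op (J := J.unop)
  apply ObjectProperty.op_injective
  rw [← gorenstein_op, ← gorenstein_op, h, gorenstein_gorenstein_isProjective]

variable {C}

lemma gorensteinIter_eq {X : ObjectProperty C} (h : gorenstein (gorenstein X) = gorenstein X)
    {n : ℕ} (hn : 1 ≤ n) : gorensteinIter X n = gorenstein X := by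
  induction n, hn using Nat.le_induction with
  | base => rfl
  | succ n _ ih => rw [gorensteinIter, ih, h]

end GorensteinCat

theorem theoremA (R : Type u) [CommRing R] :
    -- Gorenstein projectives: `G(P(R)) = G²(P(R))`, and likewise for every iterate
    (GorensteinCat.gorensteinProjective (ModuleCat.{u} R) =
        GorensteinCat.gorenstein (GorensteinCat.gorensteinProjective (ModuleCat.{u} R)) ∧
      ∀ n : ℕ, 1 ≤ n →
        GorensteinCat.gorensteinIter (CategoryTheory.isProjective (ModuleCat.{u} R)) n =
          GorensteinCat.gorensteinProjective (ModuleCat.{u} R)) ∧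
    -- Gorenstein injectives: `G(I(R)) = G²(I(R))`, and likewise for every iterate
    (GorensteinCat.gorensteinInjective (ModuleCat.{u} R) =
        GorensteinCat.gorenstein (GorensteinCat.gorensteinInjective (ModuleCat.{u} R)) ∧
      ∀ n : ℕ, 1 ≤ n →
        GorensteinCat.gorensteinIter (CategoryTheory.isInjective (ModuleCat.{u} R)) n =
          GorensteinCat.gorensteinInjective (ModuleCat.{u} R)) := by
  rw [GorensteinCat.gorensteinProjective_eq, GorensteinCat.gorensteinInjective_eq]
  exact ⟨⟨(GorensteinCat.gorenstein_gorenstein_isProjective _).symm, fun _ hn =>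
      GorensteinCat.gorensteinIter_eq (GorensteinCat.gorenstein_gorenstein_isProjective _) hn⟩,
    (GorensteinCat.gorenstein_gorenstein_isInjective _).symm, fun _ hn =>
      GorensteinCat.gorensteinIter_eq (GorensteinCat.gorenstein_gorenstein_isInjective _) hn⟩
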